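/- Fix a finite set $D$ and a function $f : D \times D \to D$ that is a commutative group operation on $D$ (associative, commutative, with an identity element and inverses). Let $\langle f\rangle$ be the functional clone generated by $f$, i.e. the set of all finitary operations on $D$ obtained by composition from $f$ and the projections $\pi^n_k : D^n \to D$, $\pi^n_k(x_1,\dots,x_n) = x_k$. Operations on $D$ act coefficient-wise on vectors over $D$ of a common size $n$. For a set $\mathcal F$ of operations on $D$ and a set $\mathcal S \subseteq D^n$, put $\mathcal F^0(\mathcal S) = \mathcal S$, $\mathcal F^{i+1}(\mathcal S) = \{ g(v_1,\dots,v_t) : g \in \mathcal F \text{ of arity } t,\ v_1,\dots,v_t \in \mathcal F^{i}(\mathcal S)\}$, and $Cl_{\mathcal F}(\mathcal S) = \bigcup_{i \ge 0} \mathcal F^i(\mathcal S)$. The problem $\textsc{Closure}_{\mathcal F}$ is the following decision problem: given (the size $n$,) a vector $v \in D^n$ and a finite set $\mathcal S \subseteq D^n$, with $\mathcal S$ given as a list of its elements and each vector written out as its sequence of coefficients over the alphabet $D$ with one additional separator symbol, decide whether $v \in Cl_{\mathcal F}(\mathcal S)$. **Proposition.** $\textsc{Closure}_{\langle f\rangle}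 \in \mathsf P$. That is, the language of words encoding pairs $(v, \mathcal S)$ with $v \in Cl_{\langle f\rangle}(\mathcal S)$ is decided by a deterministic Turing machine in a number of steps bounded by a polynomial in the length of the input word; the machine and the polynomial may depend on $D$ and $f$, which are not part of the input. -/

import Mathlib

namespace ClosureProblem

/-- Finitary operations on `D`: an arity `t` together with a function `D ^ t → D`. -/
abbrev Op (D : Type) : Type := Σ t : ℕ, ((Fin t → D) → D)

/-- A binary function, seen as an operation of arity two. -/
def binaryOp {D : Type} (f : D → D → D) : Op D := ⟨2, fun x => f (x 0) (x 1)⟩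

/-- `InClone F n g`: the `n`-ary operation `g` is a composition of operations of `F`
and of projections. -/
inductive InClone {D : Type} (F : Set (Op D)) (n : ℕ) : ((Fin n → D) → D) → Prop
  | proj (k : Fin n) : InClone F n (fun x => x k)
  | comp (f : Op D) (hf : f ∈ F) (g : Fin f.1 → (Fin n → D) → D)
      (hg : ∀ j, InClone F n (g j)) : InClone F n (fun x => f.2 (fun j => g j x))

/-- The functional clone generated by a set of operations. -/
def clone {D : Type} (F : Set (Op D)) : Set (Op D) := {g | InClone F g.1 g.2}

/-- The coefficient-wise action of an operation on vectors of size `n`. -/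
def Op.onVectors {D : Type} (f : Op D) {n : ℕ} (v : Fin f.1 → Fin n → D) : Fin n → D :=
  fun i => f.2 (fun j => v j i)

/-- `stage F S i` is `F ^ i (S)`: `F ^ 0 (S) = S`, and `F ^ (i + 1) (S)` is the set of all
`f (v₁, …, vₜ)` with `f ∈ F` and `v₁, …, vₜ ∈ F ^ i (S)`. -/
def stage {D : Type} (F : Set (Op D)) {n : ℕ} (S : Set (Fin n → D)) : ℕ → Set (Fin n → D)
  | 0 => S
  | i + 1 => {w | ∃ f ∈ F, ∃ v : Fin f.1 → Fin n → D, (∀ j, v j ∈ stage F S i) ∧ w = f.onVectors v}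

/-- The closure `Cl_F (S)` of a set of vectors of size `n`. -/
def Cl {D : Type} (F : Set (Op D)) {n : ℕ} (S : Set (Fin n → D)) : Set (Fin n → D) :=
  ⋃ i, stage F S i

/-- A list of vectors of size `n` as a word over `D` with one extra symbol `none`; each vector is
written as `none` followed by its coefficients. -/
def encodeVectors {D : Type} {n : ℕ} (l : List (Fin n → D)) : List (Option D) :=
  l.flatMap (fun v => none :: (List.ofFn v).map some)

/-- The decision problem `Closure_F`, as a language: the words that encode a vector `v` followed by
a list of the elements of a finite set `S` of vectors of the same size, such that `v ∈ Cl_F (S)`. -/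
def closureProblem {D : Type} (F : Set (Op D)) : Language (Option D) :=
  {w | ∃ (n : ℕ) (v : Fin n → D) (l : List (Fin n → D)),
    w = encodeVectors (v :: l) ∧ v ∈ Cl F {s | s ∈ l}}

/-- The class `P`: languages whose characteristic function is computed, on every input word, by a
multi-stack Turing machine within a number of steps polynomial in the length of the word. -/
def InP {A : Type} (L : Language A) : Prop :=
  ∃ χ : List A → Bool, (∀ w, χ w = true ↔ w ∈ L) ∧
    Nonempty (Turing.TM2ComputableInPolyTime (fun w : List A => w) Computability.encodeBool χ)

/-- `f` is the operation of a commutative group structure on `D`. -/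
def IsCommGroupOp {D : Type} (f : D → D → D) : Prop :=
  (∀ a b c, f (f a b) c = f a (f b c)) ∧ (∀ a b, f a b = f b a) ∧
    ∃ e, (∀ a, f e a = a) ∧ ∀ a, ∃ b, f b a = e

end ClosureProblem

namespace ClosureProblem

/-! ### The closure under a commutative group operation -/

section Closure

variable {D : Type}

/-! Write the group additively. As `D ^ n` is finite, zero and negatives are positive multiples, so
the closure of a nonempty `S` is the subgroup it generates (`mem_Cl_iff_mem_closure`); the closure
of the empty set is empty.

Subgroup membership is decided by eliminating one coordinate at a time. For the generators read so
far, keep the group `A` of their first coefficients, a section `P` lifting each `a ∈ A` to an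
element `(a, P a)` of their span `H`, and generators of the kernel `K = {y | (0, y) ∈ H}`. By
`IsSection.extend`, a new generator `(c, x)` adds exactly one vector to the generators of `K`,
namely `m • x - P (m • c)` with `m` the order of `c` modulo `A`. The target is read last. If its
first coefficient lies in `A`, then `m = 1` and the same formula gives the residue to be tested
against `K`; otherwise it is not in the span. So a sweep keeps the number of vectors and shortens
each by one (`solvable_iff_sweep`).

The values of `A` and `c` are finite in number and sit in the labels; `P` is a stack of columns `D →
D`, one per remaining coordinate. The choices of orders and coefficients modulo `A` are part of the
finite program. A sweep takes linear time and shrinks the data, so the total is quadratic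
(`halts_of_encode`). -/

theorem pos_of_inClone {F : Set (Op D)} (hF : ∀ f ∈ F, 0 < f.1) {n : ℕ} {g : (Fin n → D) → D}
    (hg : InClone F n g) : 0 < n := by
  induction hg with
  | proj k => exact k.pos
  | comp f hf g hg ih => exact ih ⟨0, hF f hf⟩

/-- Without nullary operations nothing can be produced from no vectors, not even the neutral one.
This is the case in which the closure differs from the generated subgroup. -/
theorem Cl_clone_empty {F : Set (Op D)} (hF : ∀ f ∈ F, 0 < f.1) {n : ℕ} :
    Cl (clone F) (∅ : Set (Fin n → D)) = ∅ := by
  refine Set.iUnion_eq_empty.2 fun i => ?_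
  induction i with
  | zero => rfl
  | succ i ih =>
    refine Set.eq_empty_of_forall_notMem ?_
    rintro w ⟨f, hf, v, hv, -⟩
    have := hv ⟨0, pos_of_inClone hF hf⟩
    rw [ih] at this
    exact this

theorem subset_Cl {F : Set (Op D)} {n : ℕ} (S : Set (Fin n → D)) : S ⊆ Cl F S :=
  fun _ hs => Set.mem_iUnion.2 ⟨0, hs⟩

theorem stage_clone_mono {F : Set (Op D)} {n : ℕ} (S : Set (Fin n → D)) :
    Monotone (stage (clone F) S) :=
  monotone_nat_of_le_succ fun _ w hw =>
    ⟨⟨1, fun x => x 0⟩, InClone.proj (F := F) (0 : Fin 1), fun _ => w, fun _ => hw, rfl⟩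

variable [AddCommGroup D]

theorem add_mem_Cl {n : ℕ} {S : Set (Fin n → D)} {x y : Fin n → D}
    (hx : x ∈ Cl (clone {binaryOp (· + ·)}) S) (hy : y ∈ Cl (clone {binaryOp (· + ·)}) S) :
    x + y ∈ Cl (clone {binaryOp (· + ·)}) S := by
  obtain ⟨i, hi⟩ := Set.mem_iUnion.1 hx
  obtain ⟨j, hj⟩ := Set.mem_iUnion.1 hy
  refine Set.mem_iUnion.2 ⟨max i j + 1, binaryOp ((· + ·) : D → D → D), ?_, ![x, y], ?_, ?_⟩
  · change InClone {binaryOp ((· + ·) : D → D → D)} 2 _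
    exact InClone.comp (n := 2) (binaryOp ((· + ·) : D → D → D)) (Set.mem_singleton _) (fun j x => x j) InClone.proj
  · intro k
    fin_cases k
    · exact stage_clone_mono S (le_max_left i j) hi
    · exact stage_clone_mono S (le_max_right i j) hj
  · rfl

theorem succ_nsmul_mem_Cl {n : ℕ} {S : Set (Fin n → D)} {x : Fin n → D}
    (hx : x ∈ Cl (clone {binaryOp (· + ·)}) S) (k : ℕ) :
    (k + 1) • x ∈ Cl (clone {binaryOp (· + ·)}) S := by
  induction k with
  | zero => simpa using hx
  | succ k ih => rw [succ_nsmul]; exact add_mem_Cl ih hx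

theorem onVectors_mem_addSubgroup {n : ℕ} (H : AddSubgroup (Fin n → D)) {t : ℕ}
    {g : (Fin t → D) → D} (hg : InClone {binaryOp (· + ·)} t g) (v : Fin t → Fin n → D)
    (hv : ∀ j, v j ∈ H) : (fun i => g fun j => v j i) ∈ H := by
  induction hg with
  | proj k => exact hv k
  | comp f hf g hg ih =>
    obtain rfl := Set.mem_singleton_iff.1 hf
    exact H.add_mem (ih (0 : Fin 2)) (ih (1 : Fin 2))

theorem mem_Cl_iff_mem_closure [Finite D] {n : ℕ} {S : Set (Fin n → D)} (hS : S.Nonempty)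
    (v : Fin n → D) :
    v ∈ Cl (clone {binaryOp (· + ·)}) S ↔ v ∈ AddSubgroup.closure S := by
  constructor
  · intro h
    obtain ⟨i, hi⟩ := Set.mem_iUnion.1 h
    clear h
    induction i generalizing v with
    | zero => exact AddSubgroup.subset_closure hi
    | succ i ih =>
      obtain ⟨g, hg, u, hu, rfl⟩ := hi
      exact onVectors_mem_addSubgroup _ hg u fun j => ih _ (hu j)
  · intro h
    obtain ⟨N, hN⟩ := Nat.exists_eq_succ_of_ne_zero (Nat.card_pos (α := Fin n → D)).ne'
    have hz (x : Fin n → D) : (N + 1) • x = 0 := by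
      rw [← Nat.succ_eq_add_one, ← hN, card_nsmul_eq_zero']
    induction h using AddSubgroup.closure_induction with
    | mem x hx => exact subset_Cl S hx
    | zero =>
      obtain ⟨s, hs⟩ := hS
      rw [← hz s]
      exact succ_nsmul_mem_Cl (subset_Cl S hs) N
    | add x y _ _ hx hy => exact add_mem_Cl hx hy
    | neg x _ hx =>
      -- `N • x` is already `-x`, but `N` may be zero and only positive multiples are available;
      -- adding the exponent `N + 1` once more gives a positive one.
      have : -x = (N + N + 1) • x := by
        rw [neg_eq_iff_add_eq_zero, add_comm, ← succ_nsmul,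
          show N + N + 1 + 1 = 2 * (N + 1) by ring, mul_nsmul', hz, nsmul_zero]
      rw [this]
      exact succ_nsmul_mem_Cl hx _

end Closure

/-! ### Elimination of one coordinate -/

section Elimination

variable {D M : Type} [AddCommGroup D] [AddCommGroup M]

/-- The order of `c` modulo `A`. -/
noncomputable def relOrder (A : AddSubgroup D) (c : D) : ℕ := addOrderOf (c : D ⧸ A)

/-- This also covers infinite order, recorded as `0`, so the elimination needs no finiteness. -/
theorem zsmul_mem_iff_relOrder_dvd (A : AddSubgroup D) (c : D) (z : ℤ) :
    z • c ∈ A ↔ (relOrder A c : ℤ) ∣ z := by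
  rw [relOrder, addOrderOf_dvd_iff_zsmul_eq_zero, ← QuotientAddGroup.mk_zsmul,
    QuotientAddGroup.eq_zero_iff]

theorem relOrder_nsmul_mem (A : AddSubgroup D) (c : D) : relOrder A c • c ∈ A := by
  rw [← natCast_zsmul, zsmul_mem_iff_relOrder_dvd]

theorem relOrder_eq_one {A : AddSubgroup D} {c : D} (h : c ∈ A) : relOrder A c = 1 := by
  rw [relOrder, AddMonoid.addOrderOf_eq_one_iff, QuotientAddGroup.eq_zero_iff]
  exact h

open Classical in
/-- An integer `z` with `d - z • c ∈ A`, if there is one. -/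
noncomputable def relCoeff (A : AddSubgroup D) (c d : D) : ℤ :=
  if h : ∃ z : ℤ, d - z • c ∈ A then h.choose else 0

theorem sub_relCoeff_mem {A : AddSubgroup D} {c d : D} {z : ℤ} (h : d - z • c ∈ A) :
    d - relCoeff A c d • c ∈ A := by
  have h' : ∃ z : ℤ, d - z • c ∈ A := ⟨z, h⟩
  rw [relCoeff, dif_pos h']
  exact h'.choose_spec

theorem mem_sup_zmultiples_iff {V : Type} [AddCommGroup V] {A : AddSubgroup V} {c d : V} :
    d ∈ A ⊔ AddSubgroup.zmultiples c ↔ ∃ z : ℤ, d - z • c ∈ A := by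
  rw [AddSubgroup.mem_sup]
  constructor
  · rintro ⟨a, ha, y, hy, rfl⟩
    obtain ⟨z, rfl⟩ := AddSubgroup.mem_zmultiples_iff.1 hy
    exact ⟨z, by simpa using ha⟩
  · rintro ⟨z, hz⟩
    exact ⟨_, hz, z • c, AddSubgroup.mem_zmultiples_iff.2 ⟨z, rfl⟩, by simp⟩

/-- `P` is a section over `A` of the first projection of `H`, whose kernel is `K`. -/
def IsSection (H : AddSubgroup (D × M)) (A : AddSubgroup D) (P : D → M) (K : AddSubgroup M) : Prop :=
  ∀ d y, (d, y) ∈ H ↔ d ∈ A ∧ y - P d ∈ K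

theorem isSection_bot : IsSection (⊥ : AddSubgroup (D × M)) ⊥ 0 ⊥ := by
  intro d y
  simp [AddSubgroup.mem_bot, Prod.ext_iff]

/-- The vector that a new generator `(c, x)` contributes to the kernel. -/
noncomputable def kernelVector (A : AddSubgroup D) (P : D → M) (c : D) (x : M) : M :=
  relOrder A c • x - P (relOrder A c • c)

/-- The section after the new generator `(c, x)`. -/
noncomputable def extendSection (A : AddSubgroup D) (P : D → M) (c : D) (x : M) (d : D) : M :=
  P (d - relCoeff A c d • c) + relCoeff A c d • x

namespace IsSection

variable {H : AddSubgroup (D × M)} {A : AddSubgroup D} {P : D → M} {K : AddSubgroup M}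

theorem apply_mem (h : IsSection H A P K) {a : D} (ha : a ∈ A) : (a, P a) ∈ H :=
  (h _ _).2 ⟨ha, by simp⟩

theorem zero_mem_iff (h : IsSection H A P K) (y : M) : (0, y) ∈ H ↔ y ∈ K := by
  -- `P` is not a homomorphism, and `P 0` need not vanish; it only lies in `K`.
  have h0 : -P 0 ∈ K := by simpa using ((h 0 0).1 H.zero_mem).2
  rw [h, sub_eq_add_neg, K.add_mem_cancel_right h0]
  exact and_iff_right A.zero_mem

/-- The integers `z` with `d - z • c ∈ A` form one class modulo `relOrder A c`, so `z = relCoeff A c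
d + relOrder A c * q`. Clearing the first coordinate with lifts from `P` leaves a condition on `K`
in which `q` multiplies the kernel vector. -/
theorem extend (h : IsSection H A P K) (c : D) (x : M) :
    IsSection (H ⊔ AddSubgroup.zmultiples (c, x)) (A ⊔ AddSubgroup.zmultiples c)
      (extendSection A P c x) (K ⊔ AddSubgroup.zmultiples (kernelVector A P c x)) := by
  have key (d : D) (y : M) (q : ℤ) (hj : d - relCoeff A c d • c ∈ A) :
      (d, y) - (relCoeff A c d + relOrder A c * q) • (c, x) ∈ H ↔
        y - extendSection A P c x d - q • kernelVector A P c x ∈ K := by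
    have h1 := H.sub_mem (H.zsmul_mem (h.apply_mem (relOrder_nsmul_mem A c)) q) (h.apply_mem hj)
    rw [← h.zero_mem_iff, ← H.add_mem_cancel_right h1]
    refine iff_of_eq (congrArg (· ∈ H) (Prod.ext ?_ ?_))
    · simp only [Prod.fst_add, Prod.fst_sub, Prod.smul_fst, add_zsmul, mul_comm _ q, mul_zsmul,
        natCast_zsmul]
      abel
    · simp only [Prod.snd_add, Prod.snd_sub, Prod.smul_snd, add_zsmul, mul_comm _ q, mul_zsmul,
        natCast_zsmul, extendSection, kernelVector, zsmul_sub]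
      abel
  intro d y
  simp only [mem_sup_zmultiples_iff]
  constructor
  · rintro ⟨z, hz⟩
    have hzA : d - z • c ∈ A := ((h _ _).1 hz).1
    have hj := sub_relCoeff_mem hzA
    obtain ⟨q, hq⟩ : (relOrder A c : ℤ) ∣ z - relCoeff A c d := by
      rw [← zsmul_mem_iff_relOrder_dvd]
      convert A.sub_mem hj hzA using 1
      rw [sub_zsmul]; abel
    refine ⟨⟨z, hzA⟩, q, (key d y q hj).1 ?_⟩
    rwa [← hq, add_sub_cancel]
  · rintro ⟨⟨z, hz⟩, q, hq⟩
    exact ⟨_, (key d y q (sub_relCoeff_mem hz)).2 hq⟩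

end IsSection

end Elimination

/-! ### Elimination on lists of vectors -/

section Lists

variable {D : Type}

theorem closure_image_cons {V : Type} [AddCommGroup V] (φ : List D → V) (g : List D)
    (gens : List (List D)) :
    AddSubgroup.closure (φ '' {v | v ∈ g :: gens}) =
      AddSubgroup.zmultiples (φ g) ⊔ AddSubgroup.closure (φ '' {v | v ∈ gens}) := by
  rw [AddSubgroup.zmultiples_eq_closure, ← AddSubgroup.closure_union]
  congr 1
  ext; simp [eq_comm]

variable [AddCommGroup D]

/-- A list of coefficients as a sequence that is eventually zero. -/
def vec (l : List D) (i : ℕ) : D := l.getD i 0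

@[simp] theorem vec_nil : vec ([] : List D) = 0 := by
  funext i; simp [vec]

@[simp] theorem vec_cons_zero (c : D) (x : List D) : vec (c :: x) 0 = c := rfl

@[simp] theorem vec_cons_succ (c : D) (x : List D) (i : ℕ) : vec (c :: x) (i + 1) = vec x i := rfl

/-- A list of columns as a table of sequences. -/
def table (T : List (D → D)) (d : D) (i : ℕ) : D := T.getD i 0 d

@[simp] theorem table_nil : table ([] : List (D → D)) = 0 := by
  funext d i; simp [table]

theorem table_zero (T : List (D → D)) (d : D) : table T d 0 = T.headD 0 d := by
  cases T <;> rfl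

theorem table_succ (T : List (D → D)) (d : D) (i : ℕ) : table T d (i + 1) = table T.tail d i := by
  cases T <;> simp [table]

/-- The coefficients of `kernelVector`. -/
noncomputable def kernelRow (A : AddSubgroup D) (c : D) : List D → List (D → D) → List D
  | [], _ => []
  | x :: xs, T => kernelVector A (T.headD 0) c x :: kernelRow A c xs T.tail

/-- The columns of `extendSection`. -/
noncomputable def extendTable (A : AddSubgroup D) (c : D) : List D → List (D → D) → List (D → D)
  | [], T => T
  | x :: xs, T => extendSection A (T.headD 0) c x :: extendTable A c xs T.tail

@[simp] theorem length_kernelRow (A : AddSubgroup D) (c : D) (x : List D) (T : List (D → D)) :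
    (kernelRow A c x T).length = x.length := by
  induction x generalizing T with
  | nil => rfl
  | cons a x ih => simp [kernelRow, ih]

theorem length_extendTable (A : AddSubgroup D) (c : D) (x : List D) (T : List (D → D)) :
    (extendTable A c x T).length = max x.length T.length := by
  induction x generalizing T with
  | nil => simp [extendTable]
  | cons a x ih => simp only [extendTable, List.length_cons, ih, List.length_tail]; omega

/-- The row stops where `x` does; the length hypothesis ensures that no nonzero column is cut off.
-/
theorem vec_kernelRow (A : AddSubgroup D) (c : D) (x : List D) (T : List (D → D))
    (h : T.length ≤ x.length) :
    vec (kernelRow A c x T) = kernelVector A (table T) c (vec x) := by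
  induction x generalizing T with
  | nil =>
    obtain rfl := List.length_eq_zero_iff.1 (Nat.le_zero.1 h)
    simp [kernelRow, kernelVector]
  | cons a x ih =>
    funext i
    cases i with
    | zero => simp [kernelRow, kernelVector, table_zero]
    | succ i =>
      have := congrFun (ih T.tail (by simpa using h)) i
      simpa [kernelRow, kernelVector, table_succ] using this

theorem table_extendTable (A : AddSubgroup D) (c : D) (x : List D) (T : List (D → D))
    (h : T.length ≤ x.length) :
    table (extendTable A c x T) = extendSection A (table T) c (vec x) := by
  induction x generalizing T with
  | nil =>
    obtain rfl := List.length_eq_zero_iff.1 (Nat.le_zero.1 h)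
    funext d
    simp [extendTable, extendSection]
  | cons a x ih =>
    funext d i
    cases i with
    | zero => simp [extendTable, extendSection, table_zero]
    | succ i =>
      have := congrFun (congrFun (ih T.tail (by simpa using h)) d) i
      simpa [extendTable, extendSection, table_succ] using this

/-- Elimination of the first coordinate from a list of vectors. -/
noncomputable def sweep : AddSubgroup D → List (D → D) → List (List D) → List (List D)
  | _, _, [] => []
  | A, T, [] :: vs => [] :: sweep A T vs
  | A, T, (c :: x) :: vs =>
    kernelRow A c x T :: sweep (A ⊔ AddSubgroup.zmultiples c) (extendTable A c x T) vs

/-- One output per input, one coefficient shorter: this keeps the repeated sweeps polynomial. -/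
theorem map_length_sweep (A : AddSubgroup D) (T : List (D → D)) (vs : List (List D)) :
    (sweep A T vs).map List.length = vs.map fun v => v.length - 1 := by
  induction vs generalizing A T with
  | nil => rfl
  | cons v vs ih => cases v <;> simp [sweep, ih]

/-- What is recorded about the vectors seen in a sweep: the number of those of length zero
(cut off at two), whether there was one of positive length, and whether the first coefficient of
the last one was in the group generated by the first coefficients of the preceding ones. -/
structure Flags where
  empties : Fin 3
  nonempty : Bool
  ok : Bool

open Classical in
/-- The update of the flags by a vector. -/
noncomputable def Flags.next (A : AddSubgroup D) (fl : Flags) : List D → Flags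
  | [] => ⟨if fl.empties = 0 then 1 else 2, fl.nonempty, fl.ok⟩
  | c :: _ => ⟨fl.empties, true, decide (c ∈ A)⟩

/-- The flags after a sweep. -/
noncomputable def scan : AddSubgroup D → Flags → List (List D) → Flags
  | _, fl, [] => fl
  | A, fl, [] :: vs => scan A (fl.next A []) vs
  | A, fl, (c :: x) :: vs => scan (A ⊔ AddSubgroup.zmultiples c) (fl.next A (c :: x)) vs

theorem scan_empties (A : AddSubgroup D) (fl : Flags) (vs : List (List D)) :
    ((scan A fl vs).empties : ℕ) = min 2 (fl.empties + vs.countP List.isEmpty) := by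
  induction vs generalizing A fl with
  | nil => simp [scan]; omega
  | cons v vs ih =>
    cases v with
    | nil =>
      obtain ⟨e, b, c⟩ := fl
      fin_cases e <;> simp [scan, ih, Flags.next] <;> omega
    | cons c x => simp [scan, ih, Flags.next]

theorem scan_nonempty (A : AddSubgroup D) (fl : Flags) (vs : List (List D)) :
    (scan A fl vs).nonempty = (fl.nonempty || vs.any fun v => !v.isEmpty) := by
  induction vs generalizing A fl with
  | nil => simp [scan]
  | cons v vs ih => cases v <;> simp [scan, ih, Flags.next]

/-! ### Solvability and its reduction by one coordinate -/

/-- All vectors have the same length and the last one is in the group generated by the others,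
of which there is at least one. -/
def Solvable (vs : List (List D)) : Prop :=
  ∃ n, (∀ v ∈ vs, v.length = n) ∧ ∃ gens t, vs = gens ++ [t] ∧ gens ≠ [] ∧
    vec t ∈ AddSubgroup.closure (vec '' {g | g ∈ gens})

/-- A vector as a pair of its first coefficient and the others. -/
def splitVec (l : List D) : D × (ℕ → D) := (vec l 0, fun i => vec l (i + 1))

theorem splitVec_mem_closure_iff (gens : Set (List D)) (t : List D) :
    splitVec t ∈ AddSubgroup.closure (splitVec '' gens) ↔
      vec t ∈ AddSubgroup.closure (vec '' gens) := by
  let φ : (ℕ → D) →+ D × (ℕ → D) :=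
    { toFun := fun w => (w 0, fun i => w (i + 1)), map_zero' := rfl, map_add' := fun _ _ => rfl }
  have hφ : Function.Injective φ := by
    intro v w h
    funext i
    cases i with
    | zero => exact congrArg Prod.fst h
    | succ i => exact congrFun (congrArg Prod.snd h) i
  have : splitVec '' gens = φ '' (vec '' gens) := by rw [Set.image_image]; rfl
  rw [this, ← AddMonoidHom.map_closure]
  exact AddSubgroup.mem_map_iff_mem hφ

/-- The section invariant is carried through the generators. The flags `fl` may be arbitrary because
every nonempty vector overwrites `ok`, so the target has the last word. -/
theorem sweep_append_last {A : AddSubgroup D} {T : List (D → D)} {H : AddSubgroup (D × (ℕ → D))}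
    {K : AddSubgroup (ℕ → D)} (hS : IsSection H A (table T) K) (fl : Flags) {n : ℕ}
    (hT : T.length ≤ n) (gens : List (List D)) (hg : ∀ g ∈ gens, g.length = n + 1) (t : List D)
    (ht : t.length = n + 1) :
    ∃ outs o, sweep A T (gens ++ [t]) = outs ++ [o] ∧ outs.length = gens.length ∧
      (splitVec t ∈ H ⊔ AddSubgroup.closure (splitVec '' {g | g ∈ gens}) ↔
        (scan A fl (gens ++ [t])).ok = true ∧
          vec o ∈ K ⊔ AddSubgroup.closure (vec '' {g | g ∈ outs})) := by
  induction gens generalizing A T H K fl with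
  | nil =>
    obtain - | ⟨c, x⟩ := t
    · simp at ht
    have hx : x.length = n := by simpa using ht
    refine ⟨[], kernelRow A c x T, by simp [sweep], rfl, ?_⟩
    simp only [List.not_mem_nil, Set.ofPred_false, Set.image_empty, AddSubgroup.closure_empty,
      sup_bot_eq, List.nil_append, scan, Flags.next, decide_eq_true_eq]
    rw [show splitVec (c :: x) = (c, vec x) from rfl, hS]
    refine and_congr_right fun hc => ?_
    -- With relative order one, the kernel vector of the target is its residue `x - P c`.
    rw [vec_kernelRow _ _ _ _ (hT.trans hx.ge), kernelVector, relOrder_eq_one hc, one_nsmul,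
      one_nsmul]
  | cons g gens ih =>
    obtain - | ⟨c, x⟩ := g
    · simpa using hg [] (by simp)
    have hx : x.length = n := by simpa using hg (c :: x) (by simp)
    have hT' := hT.trans hx.ge
    have hS' := hS.extend c (vec x)
    rw [← table_extendTable _ _ _ _ hT'] at hS'
    obtain ⟨outs, o, h1, h2, h3⟩ := ih hS' (fl.next A (c :: x))
      (by rw [length_extendTable]; omega) fun g hg' => hg g (by simp [hg'])
    refine ⟨kernelRow A c x T :: outs, o, by simp [sweep, h1], by simp [h2], ?_⟩
    rw [closure_image_cons, closure_image_cons, ← sup_assoc, ← sup_assoc,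
      vec_kernelRow _ _ _ _ hT']
    exact h3

/-- In dimension zero membership is automatic; what remains is to have a target and at least one
generator, hence the cut-off at two. -/
theorem solvable_iff_of_nonempty_eq_false (vs : List (List D))
    (h : (scan ⊥ ⟨0, false, false⟩ vs).nonempty = false) :
    Solvable vs ↔ (scan ⊥ ⟨0, false, false⟩ vs).empties = 2 := by
  have hv : ∀ v ∈ vs, v = [] := by simpa [scan_nonempty] using h
  have he := scan_empties ⊥ ⟨0, false, false⟩ vs
  have hc : vs.countP List.isEmpty = vs.length := by
    rw [List.countP_eq_length]; simpa using hv
  have h2 : (scan ⊥ ⟨0, false, false⟩ vs).empties = 2 ↔ 2 ≤ vs.length := by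
    rw [Fin.ext_iff, he, hc]
    simp
  rw [h2]
  constructor
  · rintro ⟨n, -, gens, t, rfl, hg, -⟩
    have := List.length_pos_iff.2 hg
    simp; omega
  · intro hl
    have hne : vs ≠ [] := by rintro rfl; simp at hl
    refine ⟨0, fun v hv' => by simp [hv v hv'], vs.dropLast, vs.getLast hne,
      (List.dropLast_append_getLast hne).symm, ?_, ?_⟩
    · rw [← List.length_pos_iff, List.length_dropLast]; omega
    · rw [hv _ (List.getLast_mem hne), vec_nil]
      exact zero_mem _

theorem not_solvable_of_empties_ne_zero (vs : List (List D))
    (h : (scan ⊥ ⟨0, false, false⟩ vs).nonempty = true)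
    (h' : (scan ⊥ ⟨0, false, false⟩ vs).empties ≠ 0) : ¬ Solvable vs := by
  rintro ⟨n, hn, -⟩
  obtain ⟨v, hv, hv0⟩ : ∃ v ∈ vs, v ≠ [] := by simpa [scan_nonempty] using h
  have he := scan_empties ⊥ ⟨0, false, false⟩ vs
  have hc : 0 < vs.countP List.isEmpty := by
    refine Nat.pos_of_ne_zero fun h0 => h' ?_
    rw [Fin.ext_iff, he, h0]
    rfl
  obtain ⟨w, hw, hw0⟩ := List.countP_pos_iff.1 hc
  have := (hn v hv).trans (hn w hw).symm
  rw [List.isEmpty_iff.1 hw0] at this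
  exact hv0 (List.length_eq_zero_iff.1 this)

theorem solvable_iff_sweep (vs : List (List D))
    (h : (scan ⊥ ⟨0, false, false⟩ vs).nonempty = true)
    (h' : (scan ⊥ ⟨0, false, false⟩ vs).empties = 0) :
    Solvable vs ↔ (scan ⊥ ⟨0, false, false⟩ vs).ok = true ∧ Solvable (sweep ⊥ [] vs) := by
  have he := scan_empties ⊥ ⟨0, false, false⟩ vs
  have hv : ∀ v ∈ vs, v ≠ [] := by
    rw [h'] at he
    have hc : vs.countP List.isEmpty = 0 := by simp at he; omega
    simpa [List.countP_eq_zero] using hc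
  have hlen := map_length_sweep ⊥ [] vs
  have main : ∀ n gens t, (∀ v ∈ vs, v.length = n) → vs = gens ++ [t] →
      ∃ outs o, sweep ⊥ [] vs = outs ++ [o] ∧ outs.length = gens.length ∧
      (vec t ∈ AddSubgroup.closure (vec '' {g | g ∈ gens}) ↔
        (scan ⊥ ⟨0, false, false⟩ vs).ok = true ∧
          vec o ∈ AddSubgroup.closure (vec '' {g | g ∈ outs})) := by
    rintro n gens t hn rfl
    obtain ⟨m, rfl⟩ : ∃ m, n = m + 1 := by
      refine Nat.exists_eq_succ_of_ne_zero ?_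
      rw [← hn t (by simp), ne_eq, List.length_eq_zero_iff]
      exact hv t (by simp)
    have := sweep_append_last (A := ⊥) (T := []) (H := ⊥) (K := ⊥)
      (by rw [table_nil]; exact isSection_bot) ⟨0, false, false⟩ (Nat.zero_le m) gens
      (fun g hg => hn g (by simp [hg])) t (hn t (by simp))
    simpa only [bot_sup_eq, splitVec_mem_closure_iff] using this
  constructor
  · rintro ⟨n, hn, gens, t, hvs, hg, ht⟩
    obtain ⟨outs, o, h1, h2, h3⟩ := main n gens t hn hvs
    obtain ⟨hok, ho⟩ := h3.1 ht
    refine ⟨hok, n - 1, ?_, outs, o, h1, ?_, ho⟩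
    · intro v hv'
      have := List.mem_map_of_mem (f := List.length) hv'
      rw [hlen] at this
      obtain ⟨w, hw, hw'⟩ := List.mem_map.1 this
      rw [← hw', hn w hw]
    · rw [← List.length_pos_iff] at hg ⊢; omega
  · rintro ⟨hok, n, hn, outs, o, hvs, hg, ho⟩
    -- Equal lengths after the sweep give equal lengths before it only because no vector is empty:
    -- the subtraction of one is truncated.
    have hn' : ∀ v ∈ vs, v.length = n + 1 := by
      intro v hv'
      have := List.mem_map_of_mem (f := fun v : List D => v.length - 1) hv'
      rw [← hlen] at this
      obtain ⟨w, hw, hw'⟩ := List.mem_map.1 this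
      have h1 := List.length_pos_iff.2 (hv v hv')
      rw [hn w hw] at hw'
      omega
    have hne : vs ≠ [] := by
      rintro rfl
      simp [sweep] at hvs
    obtain ⟨outs', o', h1, h2, h3⟩ := main (n + 1) vs.dropLast (vs.getLast hne) hn'
      (List.dropLast_append_getLast hne).symm
    obtain ⟨rfl, h4⟩ := List.append_inj' (hvs.symm.trans h1) rfl
    obtain rfl : o = o' := by simpa using h4
    refine ⟨n + 1, hn', _, _, (List.dropLast_append_getLast hne).symm, ?_, h3.2 ⟨hok, ho⟩⟩
    rw [← List.length_pos_iff] at hg ⊢; omega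

end Lists

/-! ### The machine -/

open Turing

/-- The stacks: the input, the vectors during a sweep, the table, the part of the table that
belongs to the coefficients already passed, and the output. -/
inductive Stack
  | inp
  | work
  | tab
  | aux
  | out
  deriving DecidableEq

instance : Fintype Stack :=
  ⟨{.inp, .work, .tab, .aux, .out}, fun k => by cases k <;> decide⟩

/-- The alphabets of the stacks. -/
abbrev Symbol (D : Type) : Stack → Type
  | .inp => Option D
  | .work => Option D
  | .tab => D → D
  | .aux => D → D
  | .out => Bool

/-- The contents of the contents while the output stack is empty. -/
def contents {D : Type} (i w : List (Option D)) (t a : List (D → D)) : ∀ k, List (Symbol D k)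
  | .inp => i
  | .work => w
  | .tab => t
  | .aux => a
  | .out => []

section Stacks

open Function

variable {D : Type} (i w : List (Option D)) (t a : List (D → D))

@[simp] theorem contents_inp : contents i w t a .inp = i := rfl
@[simp] theorem contents_work : contents i w t a .work = w := rfl
@[simp] theorem contents_tab : contents i w t a .tab = t := rfl
@[simp] theorem contents_aux : contents i w t a .aux = a := rfl
@[simp] theorem contents_out : contents i w t a .out = [] := rfl

@[simp] theorem update_contents_inp (l : List (Option D)) :
    update (contents i w t a) .inp l = contents l w t a := by
  funext k; cases k <;> rfl

@[simp] theorem update_contents_work (l : List (Option D)) :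
    update (contents i w t a) .work l = contents i l t a := by
  funext k; cases k <;> rfl

@[simp] theorem update_contents_tab (l : List (D → D)) :
    update (contents i w t a) .tab l = contents i w l a := by
  funext k; cases k <;> rfl

@[simp] theorem update_contents_aux (l : List (D → D)) :
    update (contents i w t a) .aux l = contents i w t l := by
  funext k; cases k <;> rfl

end Stacks

/-- The registers: the last symbols read, and a bit. -/
structure Reg (D : Type) where
  sym : Option (Option D)
  col : Option (D → D)
  bit : Bool

instance {D : Type} [Finite D] : Finite (Reg D) :=
  Finite.of_injective (fun r : Reg D => (r.sym, r.col, r.bit)) fun ⟨_, _, _⟩ ⟨_, _, _⟩ h => by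
    simpa using h

instance : Finite Flags :=
  Finite.of_injective (fun r : Flags => (r.empties, r.nonempty, r.ok))
    fun ⟨_, _, _⟩ ⟨_, _, _⟩ h => by simpa using h

variable {D : Type} [AddCommGroup D]

/-- The labels of the machine. -/
inductive Label (D : Type) [AddCommGroup D]
  | flip
  | start (A : AddSubgroup D) (fl : Flags)
  | inner (A : AddSubgroup D) (c : D) (fl : Flags)
  | unwind (A : AddSubgroup D) (fl : Flags)
  | clear
  | clean (b : Bool)

instance [Finite D] : Finite (Label D) := by
  refine Finite.of_surjective (α := Unit ⊕ (AddSubgroup D × Flags) ⊕ (AddSubgroup D × D × Flags) ⊕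
    (AddSubgroup D × Flags) ⊕ Unit ⊕ Bool)
    (Sum.elim (fun _ => .flip) <| Sum.elim (fun p => .start p.1 p.2) <|
      Sum.elim (fun p => .inner p.1 p.2.1 p.2.2) <| Sum.elim (fun p => .unwind p.1 p.2) <|
      Sum.elim (fun _ => .clear) fun b => .clean b) ?_
  rintro (_ | ⟨A, fl⟩ | ⟨A, c, fl⟩ | ⟨A, fl⟩ | _ | b)
  · exact ⟨.inl (), rfl⟩
  · exact ⟨.inr (.inl (A, fl)), rfl⟩
  · exact ⟨.inr (.inr (.inl (A, c, fl))), rfl⟩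
  · exact ⟨.inr (.inr (.inr (.inl (A, fl)))), rfl⟩
  · exact ⟨.inr (.inr (.inr (.inr (.inl ())))), rfl⟩
  · exact ⟨.inr (.inr (.inr (.inr (.inr b)))), rfl⟩

/-- Where to go at the end of a sweep. -/
def finish (fl : Flags) : Label D :=
  if fl.nonempty then if fl.empties = 0 ∧ fl.ok then .clear else .clean false
  else .clean (decide (fl.empties = 2))

open TM2.Stmt in
/-- The program of the machine. -/
noncomputable def program : Label D → TM2.Stmt (Symbol D) (Label D) (Reg D)
  | .flip =>
    pop .inp (fun s x => { s with sym := x }) <|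
    branch (fun s => s.sym.isSome)
      (push .work (fun s => s.sym.getD none) <| goto fun _ => .flip)
      (goto fun _ => .start ⊥ ⟨0, false, false⟩)
  | .start A fl =>
    pop .work (fun s x => { s with sym := x }) <|
    branch (fun s => (s.sym.map Option.isNone).getD false)
      (push .inp (fun _ => none) <| goto fun _ => .start A (fl.next A []))
      (goto fun s => match s.sym with
        | some (some c) => .inner A c fl
        | _ => finish fl)
  | .inner A c fl =>
    pop .work (fun s x => { s with sym := x }) <|
    branch (fun s => s.sym.isSome)
      (branch (fun s => (s.sym.getD none).isSome)
        -- An exhausted table pops `none`, read as the zero column; thus the table grows from `[]`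
        -- while the first vector is read.
        (pop .tab (fun s t => { s with col := t }) <|
          push .inp (fun s => (s.sym.getD none).map (kernelVector A (s.col.getD 0) c)) <|
          push .aux (fun s => extendSection A (s.col.getD 0) c ((s.sym.getD none).getD 0)) <|
          goto fun _ => .inner A c fl)
        (push .inp (fun _ => none) <|
          goto fun _ => .unwind (A ⊔ AddSubgroup.zmultiples c) (fl.next A [c])))
      (goto fun _ => .clean false)
  | .unwind A fl =>
    pop .aux (fun s t => { s with col := t }) <|
    branch (fun s => s.col.isSome)
      (push .tab (fun s => s.col.getD 0) <| goto fun _ => .unwind A fl)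
      (goto fun _ => .start A fl)
  | .clear =>
    pop .tab (fun s t => { s with col := t }) <|
    branch (fun s => s.col.isSome) (goto fun _ => .clear) (goto fun _ => .flip)
  | .clean b =>
    pop .inp (fun s x => { s with bit := x.isSome }) <|
    pop .work (fun s x => { s with bit := s.bit || x.isSome }) <|
    pop .tab (fun s x => { s with bit := s.bit || x.isSome }) <|
    pop .aux (fun s x => { s with bit := s.bit || x.isSome }) <|
    branch (fun s => s.bit) (goto fun _ => .clean b)
      -- `haltList` requires the initial register and, apart from the output, empty stacks.
      (load (fun _ => ⟨none, none, false⟩) <| push .out (fun _ => b) halt)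

/-- The machine. -/
noncomputable def machine (D : Type) [AddCommGroup D] [Finite D] : FinTM2 :=
  have := Fintype.ofFinite D
  { K := Stack
    k₀ := .inp
    k₁ := .out
    Γ := Symbol D
    Λ := Label D
    main := .flip
    ΛFin := Fintype.ofFinite _
    σ := Reg D
    initialState := ⟨none, none, false⟩
    σFin := Fintype.ofFinite _
    Γk₀Fin := (inferInstance : Fintype (Option D))
    m := program }

/-- The machine reaches the second label and contents from the first ones in at most `k` steps. -/
def Reach (k : ℕ) (l : Label D) (S : ∀ k, List (Symbol D k)) (l' : Label D)
    (S' : ∀ k, List (Symbol D k)) : Prop :=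
  ∀ s, ∃ s', ∃ j ≤ k, (flip bind (TM2.step program))^[j] (some ⟨some l, s, S⟩) =
    some ⟨some l', s', S'⟩

/-- The machine halts with output `b` in at most `k` steps. -/
def Halts (k : ℕ) (l : Label D) (S : ∀ k, List (Symbol D k)) (b : Bool) : Prop :=
  ∀ s, ∃ j ≤ k, (flip bind (TM2.step program))^[j] (some ⟨some l, s, S⟩) =
    some ⟨none, ⟨none, none, false⟩, Function.update (contents [] [] [] []) .out [b]⟩

section Run

variable {k k' : ℕ} {l l' l'' : Label D} {S S' S'' : ∀ k, List (Symbol D k)}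

theorem Reach.refl (l : Label D) (S : ∀ k, List (Symbol D k)) : Reach 0 l S l S :=
  fun s => ⟨s, 0, le_rfl, rfl⟩

theorem Reach.trans (h : Reach k l S l' S') (h' : Reach k' l' S' l'' S'') :
    Reach (k + k') l S l'' S'' := by
  intro s
  obtain ⟨s', j, hj, e⟩ := h s
  obtain ⟨s'', j', hj', e'⟩ := h' s'
  exact ⟨s'', j' + j, by omega, by rw [Function.iterate_add_apply, e, e']⟩

theorem Reach.mono (h : Reach k l S l' S') (hk : k ≤ k') : Reach k' l S l' S' := by
  intro s
  obtain ⟨s', j, hj, e⟩ := h s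
  exact ⟨s', j, hj.trans hk, e⟩

theorem Reach.halts {b : Bool} (h : Reach k l S l' S') (h' : Halts k' l' S' b) :
    Halts (k + k') l S b := by
  intro s
  obtain ⟨s', j, hj, e⟩ := h s
  obtain ⟨j', hj', e'⟩ := h' s'
  exact ⟨j' + j, by omega, by rw [Function.iterate_add_apply, e, e']⟩

theorem Halts.mono {b : Bool} (h : Halts k l S b) (hk : k ≤ k') : Halts k' l S b := by
  intro s
  obtain ⟨j, hj, e⟩ := h s
  exact ⟨j, hj.trans hk, e⟩

/-- A TM2 step runs the whole statement of a label, so each visit to a label costs one. -/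
theorem Reach.step (h : ∀ s, ∃ s', TM2.stepAux (program l) s S = ⟨some l', s', S'⟩) :
    Reach 1 l S l' S' := by
  intro s
  obtain ⟨s', e⟩ := h s
  exact ⟨s', 1, le_rfl, congrArg some e⟩

theorem Halts.step {b : Bool} (h : ∀ s, TM2.stepAux (program l) s S =
    ⟨none, ⟨none, none, false⟩, Function.update (contents [] [] [] []) .out [b]⟩) :
    Halts 1 l S b :=
  fun s => ⟨1, le_rfl, congrArg some (h s)⟩

end Run

/-! ### Step counts of the phases -/

theorem reach_flip (i w : List (Option D)) (t a : List (D → D)) :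
    Reach (i.length + 1) .flip (contents i w t a) (.start ⊥ ⟨0, false, false⟩)
      (contents [] (i.reverse ++ w) t a) := by
  induction i generalizing w with
  | nil => exact .step fun s => ⟨_, by simp [program]; rfl⟩
  | cons x i ih =>
    have h : Reach 1 .flip (contents (x :: i) w t a) .flip (contents i (x :: w) t a) :=
      .step fun s => ⟨_, by simp [program]; rfl⟩
    simpa [add_comm, add_left_comm, add_assoc] using h.trans (ih _)

theorem reach_clear (i w : List (Option D)) (t a : List (D → D)) :
    Reach (t.length + 1) .clear (contents i w t a) .flip (contents i w [] a) := by
  induction t with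
  | nil => exact .step fun s => ⟨_, by simp [program]; rfl⟩
  | cons x t ih =>
    have h : Reach 1 .clear (contents i w (x :: t) a) .clear (contents i w t a) :=
      .step fun s => ⟨_, by simp [program]; rfl⟩
    exact (h.trans ih).mono (by simp; omega)

theorem reach_unwind (A : AddSubgroup D) (fl : Flags) (i w : List (Option D))
    (t a : List (D → D)) :
    Reach (a.length + 1) (.unwind A fl) (contents i w t a) (.start A fl)
      (contents i w (a.reverseAux t) []) := by
  induction a generalizing t with
  | nil => exact .step fun s => ⟨_, by simp [program]; rfl⟩
  | cons x a ih =>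
    have h : Reach 1 (.unwind A fl) (contents i w t (x :: a)) (.unwind A fl)
        (contents i w (x :: t) a) :=
      .step fun s => ⟨_, by simp [program]; rfl⟩
    exact (h.trans (ih _)).mono (by simp; omega)

theorem halts_clean (b : Bool) (i w : List (Option D)) (t a : List (D → D)) :
    Halts (i.length + w.length + t.length + a.length + 1) (.clean b) (contents i w t a) b := by
  generalize hn : i.length + w.length + t.length + a.length = n
  induction n using Nat.strong_induction_on generalizing i w t a with
  | _ n ih =>
    by_cases h0 : n = 0
    · have hi : i = [] := List.length_eq_zero_iff.1 (by omega)
      have hw : w = [] := List.length_eq_zero_iff.1 (by omega)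
      have ht : t = [] := List.length_eq_zero_iff.1 (by omega)
      have ha : a = [] := List.length_eq_zero_iff.1 (by omega)
      subst hi hw ht ha
      exact (Halts.step fun s => by simp [program]).mono (by omega)
    · have h : Reach 1 (.clean b) (contents i w t a) (.clean b)
          (contents i.tail w.tail t.tail a.tail) := by
        refine .step fun s => ?_
        have hb : (((i.head?.isSome || w.head?.isSome) || t.head?.isSome) || a.head?.isSome) = true := by
          rcases i with _ | _ <;> rcases w with _ | _ <;> rcases t with _ | _ <;>
            rcases a with _ | _ <;> first | rfl | exact absurd hn.symm h0
        simp only [program, TM2.stepAux, contents_inp, contents_work, contents_tab, contents_aux,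
          update_contents_inp, update_contents_work, update_contents_tab, update_contents_aux, hb, cond_true]
        exact ⟨_, rfl⟩
      refine (h.halts (ih (i.tail.length + w.tail.length + t.tail.length + a.tail.length) ?_ _ _ _ _
        rfl)).mono ?_ <;> simp only [List.length_tail] <;> omega

theorem reach_inner_cons (A : AddSubgroup D) (c : D) (fl : Flags) (x : D) (i w : List (Option D))
    (t a : List (D → D)) :
    Reach 1 (.inner A c fl) (contents i (some x :: w) t a) (.inner A c fl)
      (contents (some (kernelVector A (t.headD 0) c x) :: i) w t.tail
        (extendSection A (t.headD 0) c x :: a)) :=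
  .step fun s => ⟨_, by simp [program]; rfl⟩

/-- Each coefficient costs one step to process and one to move its new column back from `aux`; the
separator and the end of `unwind` account for the `2`. -/
theorem reach_inner (A : AddSubgroup D) (c : D) (fl : Flags) (x : List D) (i w : List (Option D))
    (t a : List (D → D)) :
    Reach (2 * x.length + a.length + 2) (.inner A c fl) (contents i (x.map some ++ none :: w) t a)
      (.start (A ⊔ AddSubgroup.zmultiples c) (fl.next A [c]))
      (contents (none :: (((kernelRow A c x t).map some).reverse ++ i)) w
        (a.reverseAux (extendTable A c x t)) []) := by
  induction x generalizing i t a with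
  | nil =>
    have h : Reach 1 (.inner A c fl) (contents i (none :: w) t a)
        (.unwind (A ⊔ AddSubgroup.zmultiples c) (fl.next A [c])) (contents (none :: i) w t a) :=
      .step fun s => ⟨_, by simp [program]; rfl⟩
    exact (h.trans (reach_unwind _ _ _ _ _ _)).mono (by simp; omega)
  | cons y x ih =>
    have h := (reach_inner_cons A c fl y i (x.map some ++ none :: w) t a).trans (ih _ _ _)
    simp only [List.map_cons, List.cons_append, kernelRow, extendTable, List.reverse_cons,
      List.append_assoc, List.nil_append]
    exact h.mono (by simp; omega)

/-- The work stack ends before a separator: the input word did not start with one and is rejected.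
-/
theorem halts_inner (A : AddSubgroup D) (c : D) (fl : Flags) (x : List D) (i : List (Option D))
    (t a : List (D → D)) :
    Halts (3 * x.length + i.length + t.length + a.length + 2) (.inner A c fl)
      (contents i (x.map some) t a) false := by
  induction x generalizing i t a with
  | nil =>
    have h : Reach 1 (.inner A c fl) (contents i [] t a) (.clean false) (contents i [] t a) :=
      .step fun s => ⟨_, by simp [program]; rfl⟩
    exact (h.halts (halts_clean _ _ _ _ _)).mono (by simp; omega)
  | cons y x ih =>
    have h := (reach_inner_cons A c fl y i (x.map some) t a).halts (ih _ _ _)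
    exact h.mono (by simp; omega)

/-- A list of vectors as it stands on the work stack, the coefficients of each vector followed by
the extra symbol. -/
def encode {D : Type} (vs : List (List D)) : List (Option D) :=
  vs.flatMap fun v => v.map some ++ [none]

theorem reach_start_cons (A : AddSubgroup D) (fl : Flags) (c : D) (i w : List (Option D))
    (t a : List (D → D)) :
    Reach 1 (.start A fl) (contents i (some c :: w) t a) (.inner A c fl) (contents i w t a) :=
  .step fun s => ⟨_, by simp [program]; rfl⟩

theorem reach_start_nil (A : AddSubgroup D) (fl : Flags) (i : List (Option D))
    (t a : List (D → D)) :
    Reach 1 (.start A fl) (contents i [] t a) (finish fl) (contents i [] t a) :=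
  .step fun s => ⟨_, by simp [program]; rfl⟩

theorem reach_sweep (A : AddSubgroup D) (fl : Flags) (vs : List (List D)) (i w : List (Option D))
    (t : List (D → D)) :
    ∃ A' t', t'.length ≤ t.length + (encode vs).length ∧
      Reach (3 * (encode vs).length) (.start A fl) (contents i (encode vs ++ w) t [])
        (.start A' (scan A fl vs)) (contents ((encode (sweep A t vs)).reverse ++ i) w t' []) := by
  induction vs generalizing A fl i t with
  | nil => exact ⟨A, t, le_self_add, .refl _ _⟩
  | cons v vs ih =>
    cases v with
    | nil =>
      have h : Reach 1 (.start A fl) (contents i (none :: (encode vs ++ w)) t [])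
          (.start A (fl.next A [])) (contents (none :: i) (encode vs ++ w) t []) :=
        .step fun s => ⟨_, by simp [program]; rfl⟩
      obtain ⟨A', t', ht, h'⟩ := ih A (fl.next A []) (none :: i) t
      have hl : (encode ([] :: vs)).length = (encode vs).length + 1 := by simp [encode]
      refine ⟨A', t', by omega, ?_⟩
      have := (h.trans h').mono (k' := 3 * (encode ([] :: vs)).length) (by omega)
      simpa [encode, sweep, scan] using this
    | cons c x =>
      obtain ⟨A', t', ht, h'⟩ := ih (A ⊔ AddSubgroup.zmultiples c) (fl.next A [c])
        (none :: (((kernelRow A c x t).map some).reverse ++ i)) (extendTable A c x t)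
      have h := ((reach_start_cons A fl c i (x.map some ++ none :: (encode vs ++ w)) t []).trans
        (reach_inner A c fl x i (encode vs ++ w) t [])).trans h'
      have hl : (encode ((c :: x) :: vs)).length = (encode vs).length + x.length + 2 := by
        simp [encode]; omega
      rw [length_extendTable] at ht
      refine ⟨A', t', by omega, ?_⟩
      have := h.mono (k' := 3 * (encode ((c :: x) :: vs)).length) (by simp; omega)
      simpa [encode, sweep, scan, Flags.next] using this

theorem length_encode {D : Type} (vs : List (List D)) :
    (encode vs).length = ((vs.map List.length).map (· + 1)).sum := by
  simp [encode, List.length_flatMap, Function.comp_def]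

theorem length_encode_sweep_le (A : AddSubgroup D) (t : List (D → D)) (vs : List (List D)) :
    (encode (sweep A t vs)).length ≤ (encode vs).length := by
  rw [length_encode, length_encode, map_length_sweep, List.map_map, List.map_map]
  exact List.sum_le_sum fun v _ => by simp

theorem length_encode_sweep_lt (A : AddSubgroup D) (t : List (D → D)) {vs : List (List D)}
    (h : ∃ v ∈ vs, v ≠ []) : (encode (sweep A t vs)).length < (encode vs).length := by
  rw [length_encode, length_encode, map_length_sweep, List.map_map, List.map_map]
  refine List.sum_lt_sum _ _ (fun v _ => by simp) ?_
  obtain ⟨v, hv, h0⟩ := h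
  refine ⟨v, hv, ?_⟩
  have := List.length_pos_iff.2 h0
  simp; omega

-- For data of length `L`, a round takes `L + 1` steps to flip, `3 * L` to sweep, one to leave the
-- sweep and at most `2 * L + 1` to clear or clean. Another round occurs only if some vector was
-- nonempty, and then `L` has dropped.
open Classical in
theorem halts_of_encode (n : ℕ) (vs : List (List D)) (hn : (encode vs).length < n) :
    Halts (n * (6 * n + 10)) .flip (contents (encode vs).reverse [] [] [])
      (decide (Solvable vs)) := by
  induction n generalizing vs with
  | zero => omega
  | succ n ih =>
    have h1 := reach_flip (encode vs).reverse [] [] []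
    obtain ⟨A', t', ht, h2⟩ := reach_sweep ⊥ ⟨0, false, false⟩ vs [] [] []
    simp only [List.reverse_reverse, List.append_nil] at h1 h2
    have h3 := (h1.trans h2).trans (reach_start_nil _ _ _ _ _)
    have hle := length_encode_sweep_le ⊥ [] vs
    simp only [List.length_reverse, List.length_nil] at h3 ht
    have hclean : finish (D := D) (scan ⊥ ⟨0, false, false⟩ vs) = .clean (decide (Solvable vs)) →
        Halts ((n + 1) * (6 * (n + 1) + 10)) .flip (contents (encode vs).reverse [] [] [])
          (decide (Solvable vs)) := by
      intro hf
      rw [hf] at h3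
      refine (h3.halts (halts_clean _ _ _ _ _)).mono ?_
      simp only [List.length_reverse, List.length_nil]
      nlinarith
    cases hne : (scan ⊥ ⟨0, false, false⟩ vs).nonempty with
    | false =>
      apply hclean
      simp [finish, hne, solvable_iff_of_nonempty_eq_false vs hne]
    | true =>
      by_cases he : (scan ⊥ ⟨0, false, false⟩ vs).empties = 0
      · have hiff := solvable_iff_sweep vs hne he
        cases hok : (scan ⊥ ⟨0, false, false⟩ vs).ok with
        | false =>
          apply hclean
          simp [finish, hne, he, hok, hiff]
        | true =>
          have hf : finish (D := D) (scan ⊥ ⟨0, false, false⟩ vs) = .clear := by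
            simp [finish, hne, he, hok]
          have hlt := length_encode_sweep_lt ⊥ [] (vs := vs) (by simpa [scan_nonempty] using hne)
          rw [hf] at h3
          have hs : Solvable (sweep ⊥ [] vs) ↔ Solvable vs := by simp [hiff, hok]
          have := (h3.trans (reach_clear _ _ _ _)).halts (ih (sweep ⊥ [] vs) (by omega))
          simp only [hs] at this
          exact this.mono (by nlinarith)
      · apply hclean
        simp [finish, hne, he, not_solvable_of_empties_ne_zero vs hne he]

theorem halts_of_not_encode (vs : List (List D)) (c : D) (ds : List D) :
    Halts (10 * ((encode vs).length + ds.length) + 10) .flip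
      (contents (encode vs ++ some c :: ds.map some).reverse [] [] []) false := by
  have h1 := reach_flip (encode vs ++ some c :: ds.map some).reverse [] [] []
  obtain ⟨A', t', ht, h2⟩ := reach_sweep ⊥ ⟨0, false, false⟩ vs [] (some c :: ds.map some) []
  rw [List.reverse_reverse, List.append_nil] at h1
  have h3 := (((h1.trans h2).trans (reach_start_cons _ _ _ _ _ _ _)).halts
    (halts_inner _ _ _ _ _ _ _))
  have hle := length_encode_sweep_le ⊥ [] vs
  refine h3.mono ?_
  simp only [List.length_reverse, List.length_nil, List.length_append, List.length_cons,
    List.length_map] at *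
  omega

/-! ### The language -/

theorem exists_decomposition {D : Type} (w : List (Option D)) :
    ∃ (ds : List D) (us : List (List D)),
      w = ds.map some ++ us.flatMap fun u => none :: u.map some := by
  induction w with
  | nil => exact ⟨[], [], rfl⟩
  | cons x w ih =>
    obtain ⟨ds, us, rfl⟩ := ih
    cases x with
    | none => exact ⟨[], ds :: us, by simp⟩
    | some d => exact ⟨d :: ds, us, by simp⟩

theorem reverse_encode {D : Type} (us : List (List D)) :
    (encode (us.reverse.map List.reverse)).reverse = us.flatMap fun u => none :: u.map some := by
  induction us with
  | nil => rfl
  | cons u us ih => simpa [encode] using ih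

/-- Reversing the coordinates and padding with zeros is an injective homomorphism. The reversal
arises because flipping the input onto the work stack reverses the word, which also brings the
target to the end. -/
theorem vec_reverse_ofFn_mem_closure_iff {n : ℕ} (v : Fin n → D) (S : Set (Fin n → D)) :
    vec (List.ofFn v).reverse ∈
        AddSubgroup.closure (vec '' ((fun s => (List.ofFn s).reverse) '' S)) ↔
      v ∈ AddSubgroup.closure S := by
  have hv (v : Fin n → D) (i : ℕ) :
      vec (List.ofFn v).reverse i = if h : i < n then v (Fin.rev ⟨i, h⟩) else 0 := by
    split_ifs with h
    · simp [vec, h, Fin.rev, Nat.sub_sub, add_comm]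
    · simp [vec, h]
  let φ : (Fin n → D) →+ (ℕ → D) :=
    { toFun := fun v => vec (List.ofFn v).reverse
      map_zero' := by funext i; simp [hv]
      map_add' := fun v w => by funext i; simp only [hv, Pi.add_apply]; split_ifs <;> simp }
  have hφ : Function.Injective φ := by
    intro v w h
    funext i
    have := congrFun h (Fin.rev i)
    simpa only [φ, AddMonoidHom.coe_mk, ZeroHom.coe_mk, hv, Fin.is_lt, dif_pos, Fin.eta, Fin.rev_rev] using this
  rw [Set.image_image, ← AddSubgroup.mem_map_iff_mem hφ, AddMonoidHom.map_closure]
  rfl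

theorem closure_image_reverse_ofFn {n : ℕ} (v : Fin n → D) (l : List (Fin n → D)) :
    vec (List.ofFn v).reverse ∈ AddSubgroup.closure
        (vec '' {g | g ∈ (l.map fun s => (List.ofFn s).reverse).reverse}) ↔
      v ∈ AddSubgroup.closure {s | s ∈ l} := by
  rw [← vec_reverse_ofFn_mem_closure_iff]
  refine iff_of_eq (congrArg (fun S => _ ∈ AddSubgroup.closure (vec '' S)) ?_)
  ext g
  simp

theorem reverse_encode_ofFn {D : Type} {n : ℕ} (l : List (Fin n → D)) :
    (encode (l.map fun s => (List.ofFn s).reverse).reverse).reverse = encodeVectors l := by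
  have := reverse_encode (l.map List.ofFn)
  rw [List.flatMap_map, ← List.map_reverse, List.map_map] at this
  rw [← List.map_reverse]
  exact this

theorem exists_solvable_of_mem_closureProblem [Finite D] {w : List (Option D)}
    (h : w ∈ closureProblem (clone {binaryOp ((· + ·) : D → D → D)})) :
    ∃ vs, w = (encode vs).reverse ∧ Solvable vs := by
  obtain ⟨n, v, l, rfl, hv⟩ := h
  refine ⟨((v :: l).map fun s => (List.ofFn s).reverse).reverse,
    (reverse_encode_ofFn _).symm, n, ?_, (l.map fun s => (List.ofFn s).reverse).reverse,
    (List.ofFn v).reverse, by simp, ?_, ?_⟩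
  · simp only [List.mem_reverse, List.mem_map]
    rintro _ ⟨s, -, rfl⟩
    simp
  all_goals
    have hl : l ≠ [] := by
      rintro rfl
      have h0 := Cl_clone_empty (F := {binaryOp ((· + ·) : D → D → D)}) (n := n) (by
        rintro f rfl
        exact Nat.two_pos)
      simp [h0] at hv
  · simpa using hl
  · rw [closure_image_reverse_ofFn, ← mem_Cl_iff_mem_closure]
    · exact hv
    · exact List.exists_mem_of_ne_nil l hl

theorem mem_closureProblem_of_solvable [Finite D] {vs : List (List D)} (h : Solvable vs) :
    (encode vs).reverse ∈ closureProblem (clone {binaryOp ((· + ·) : D → D → D)}) := by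
  obtain ⟨n, hn, gens, t, rfl, hg, ht⟩ := h
  let toFun (g : List D) (i : Fin n) : D := vec g.reverse i
  have hof (g : List D) (hg : g.length = n) : (List.ofFn (toFun g)).reverse = g := by
    rw [List.reverse_eq_iff]
    refine List.ext_getElem (by simp [hg]) fun i h1 h2 => ?_
    simp only [List.length_ofFn] at h1
    simp [toFun, vec, hg]
  have hgens : ((gens.reverse.map toFun).map fun s => (List.ofFn s).reverse).reverse = gens := by
    rw [List.map_map, ← List.map_reverse, List.reverse_reverse]
    exact (List.map_congr_left fun g hg' => hof g (hn g (by simp [hg']))).trans (List.map_id gens)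
  have ht' := hof t (hn t (by simp))
  refine ⟨n, toFun t, gens.reverse.map toFun, ?_, ?_⟩
  · rw [← reverse_encode_ofFn, List.map_cons, List.reverse_cons, hgens, ht']
  · rw [mem_Cl_iff_mem_closure, ← closure_image_reverse_ofFn, hgens, ht']
    · exact ht
    · exact List.exists_mem_of_ne_nil (gens.reverse.map toFun) (by simpa using hg)

open Classical in
theorem halts_of_input [Finite D] (w : List (Option D)) :
    Halts ((w.length + 1) * (6 * (w.length + 1) + 10)) .flip (contents w [] [] [])
      (decide (w ∈ closureProblem (clone {binaryOp ((· + ·) : D → D → D)}))) := by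
  by_cases hw : w ∈ closureProblem (clone {binaryOp ((· + ·) : D → D → D)})
  · obtain ⟨vs, rfl, hvs⟩ := exists_solvable_of_mem_closureProblem hw
    have := halts_of_encode _ vs (Nat.lt_succ_self _)
    simpa [hw, hvs] using this
  -- A rejected word either splits into vectors that are not `Solvable`, or has stray letters `ds`
  -- before its first separator.
  · obtain ⟨ds, us, h⟩ := exists_decomposition w
    rw [← reverse_encode] at h
    set vs := us.reverse.map List.reverse
    cases ds with
    | nil =>
      rw [List.map_nil, List.nil_append] at h
      subst h
      have hvs : ¬ Solvable vs := fun h => hw (mem_closureProblem_of_solvable h)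
      have := halts_of_encode _ vs (Nat.lt_succ_self _)
      simpa [hw, hvs] using this
    | cons d ds =>
      have hds : (d :: ds).reverse ≠ [] := by simp
      obtain ⟨c, cs, hc⟩ := List.exists_cons_of_ne_nil hds
      have hw' : w = (encode vs ++ some c :: cs.map some).reverse := by
        rw [h, ← List.map_cons, ← hc, List.map_reverse, List.reverse_append, List.reverse_reverse]
      have := halts_of_not_encode vs c cs
      rw [← hw'] at this
      simp only [hw, decide_false]
      have hl : w.length = (encode vs).length + cs.length + 1 := by
        rw [hw']; simp; omega
      exact this.mono (by nlinarith)

theorem initList_machine [Finite D] (w : List (Option D)) :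
    initList (machine D) w = ⟨some .flip, ⟨none, none, false⟩, contents w [] [] []⟩ := by
  refine congrArg (TM2.Cfg.mk _ _) ?_
  funext k
  cases k <;> rfl

theorem haltList_machine [Finite D] (b : Bool) :
    haltList (machine D) [b] = ⟨none, ⟨none, none, false⟩,
      Function.update (contents [] [] [] []) .out [b]⟩ := by
  refine congrArg (TM2.Cfg.mk _ _) ?_
  funext k
  cases k <;> rfl

open Classical Polynomial in
theorem closureProblem_add_inP [Finite D] :
    InP (closureProblem (clone {binaryOp ((· + ·) : D → D → D)})) := by
  refine ⟨fun w => decide (w ∈ closureProblem (clone {binaryOp ((· + ·) : D → D → D)})),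
    fun w => decide_eq_true_iff, ⟨?_⟩⟩
  refine
    { tm := machine D
      inputAlphabet := Equiv.refl (Option D)
      outputAlphabet := Equiv.refl Bool
      time := (X + 1) * (6 * (X + 1) + 10)
      outputsFun := fun w => Classical.choice ?_ }
  obtain ⟨j, hj, e⟩ := halts_of_input w ⟨none, none, false⟩
  refine ⟨⟨⟨j, ?_⟩, hj.trans_eq (by simp)⟩⟩
  refine Eq.trans (congrArg _ (congrArg some ?_)) (e.trans (congrArg some ?_))
  · exact (congrArg (initList (machine D)) (List.map_id w)).trans (initList_machine w)
  · exact (haltList_machine _).symm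

end ClosureProblem

theorem mainTheorem9 {D : Type} [Finite D] (f : D → D → D)
    (hf : ClosureProblem.IsCommGroupOp f) :
    ClosureProblem.InP
      (ClosureProblem.closureProblem (ClosureProblem.clone {ClosureProblem.binaryOp f})) := by
  obtain ⟨assoc, comm, e, he, hinv⟩ := hf
  choose inv hinv using hinv
  -- Under these instances `(· + ·)` is `f` by definition, so the additive result applies directly.
  let _ : Add D := ⟨f⟩
  let _ : Zero D := ⟨e⟩
  let _ : Neg D := ⟨inv⟩
  let _ : AddCommGroup D := { AddGroup.ofLeftAxioms assoc he hinv with add_comm := comm }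
  exact ClosureProblem.closureProblem_add_inP (D := D)
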